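/- Let $(\mathcal H,[\cdot,\cdot])$ be a Krein space (the metric being conjugate-linear in its first argument) with a fixed canonical decomposition $\mathcal H=\mathcal H^-[\oplus]\mathcal H^+$, canonical projections $P^\pm$, canonical symmetry $J=P^+-P^-$, and norm $\|x\|=\sqrt{[x,Jx]}$. Put $I^\pm=I|_{\mathcal H^\pm}$. A (linear) relation is a linear subset of a product of two linear spaces; operators are identified with their graphs, and $\mathcal D_R$ denotes the domain of $R$. Sums, products, inverses and restrictions are those of linear relations. For a relation $R$ from $\mathcal E$ to $\mathcal F$, where each of $\mathcal E,\mathcal F$ is one of $\mathcal H,\mathcal H^+,\mathcal H^-$ with the metric $[\cdot,\cdot]$, the adjoint is $R^c=\{(v,w)\in\mathcal F\times\mathcal E : [x,w]=[y,v]\ \text{for all}\ (x,y)\in R\}$. Let $T$ be a self-adjoint relation in $\mathcal H$, i.e. $T=T^c$, with $\mathcal H^-\subseteq\mathcal D_T$. For $\lambda\in\mathbb C\setminus\mathbb R$ put $$T^{--}=P^-T|_{\mathcal H^-},\qquad \mathcal L_\lambda=(T-\lambda I)^{-1}(\mathcal H^+),\qquad \gamma_\lambda=P^-(P^+|_{\mathcal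 L_\lambda})^{-1},$$ $$\mathcal T^{\pm}(\lambda)=\{(P^\pm x,P^\pm y) : (x,y)\in T,\ y-\lambda x\in\mathcal H^\pm\},$$ so that $\gamma_\lambda$ is a relation from $\mathcal H^+$ to $\mathcal H^-$ and $\mathcal T^\pm(\lambda)$ is a relation in $\mathcal H^\pm$. Then for every $\lambda\in\mathbb C\setminus\mathbb R$: a) $\mathcal L_\lambda$ is of class $\mathcal A^+$, i.e. $\mathcal H^-\cap\mathcal L_\lambda=\{0\}$. The relation $\gamma_\lambda$ is a closable operator with $$\mathcal D_{\gamma_\lambda}=P^+(\mathcal L_\lambda)=\mathcal H^+\cap\mathcal D_T=\mathcal D_{\mathcal T^+(\lambda)},\qquad \mathcal D_{\gamma_\lambda^c}=\mathcal H^-,$$ and it is bounded. Moreover $\gamma_\lambda$ is a contraction ($\|\gamma_\lambda x\|\le\|x\|$ on $\mathcal D_{\gamma_\lambda}$) if and only if $\mathcal L_\lambda$ is non-negative ($[x,x]\ge0$ for all $x\in\mathcal L_\lambda$). b) As linear relations in $\mathcal H^-$, $$(\mathcal T^-(\lambda)-\lambda I^-)^{-1}=(T^{--}-\lambda I^-)^{-1}+\gamma_\lambda\,(\mathcal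 T^+(\lambda)-\lambda I^+)^{-1}\,\gamma_{\bar\lambda}^{\,c}.$$ -/

import Mathlib

open scoped InnerProductSpace ComplexConjugate

noncomputable section

/-! ## Linear relations

A relation from `E` to `F` is a lineal (linear subset) of `E × F`. Operators are identified
with their graphs; the graph of an everywhere defined operator is `LinearMap.graph`. -/

/-- A linear relation from `E` to `F`. -/
abbrev LinRel (E F : Type*) [AddCommGroup E] [Module ℂ E] [AddCommGroup F] [Module ℂ F] :=
  Submodule ℂ (E × F)

namespace LinRel

variable {E F G : Type*} [AddCommGroup E] [Module ℂ E] [AddCommGroup F] [Module ℂ F]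
  [AddCommGroup G] [Module ℂ G]

/-- The domain `{x | ∃ y, (x, y) ∈ R}`. -/
def dom (R : LinRel E F) : Submodule ℂ E := R.map (LinearMap.fst ℂ E F)

/-- The multivalued part (indefiniteness) `{y | (0, y) ∈ R}`. -/
def ind (R : LinRel E F) : Submodule ℂ F := R.comap (LinearMap.inr ℂ E F)

/-- A relation is (the graph of) an operator when its multivalued part is trivial. -/
def IsOperator (R : LinRel E F) : Prop := R.ind = ⊥

/-- The inverse relation `{(y, x) | (x, y) ∈ R}`. -/
def inv (R : LinRel E F) : LinRel F E where
  carrier := {p | (p.2, p.1) ∈ R}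
  add_mem' := fun ha hb => R.add_mem ha hb
  zero_mem' := R.zero_mem
  smul_mem' := fun c _ ha => R.smul_mem c ha

/-- The product `S R = {(x, z) | ∃ y, (x, y) ∈ R, (y, z) ∈ S}`. -/
def comp (S : LinRel F G) (R : LinRel E F) : LinRel E G where
  carrier := {p | ∃ y, (p.1, y) ∈ R ∧ (y, p.2) ∈ S}
  add_mem' := by
    rintro a b ⟨y, h1, h2⟩ ⟨y', h1', h2'⟩
    exact ⟨y + y', R.add_mem h1 h1', S.add_mem h2 h2'⟩
  zero_mem' := ⟨0, R.zero_mem, S.zero_mem⟩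
  smul_mem' := by
    rintro c a ⟨y, h1, h2⟩
    exact ⟨c • y, R.smul_mem c h1, S.smul_mem c h2⟩

/-- The operator-like sum `R + S = {(x, y + z) | (x, y) ∈ R, (x, z) ∈ S}`. -/
def opSum (R S : LinRel E F) : LinRel E F where
  carrier := {p | ∃ y z, (p.1, y) ∈ R ∧ (p.1, z) ∈ S ∧ p.2 = y + z}
  add_mem' := by
    rintro a b ⟨y, z, h1, h2, h3⟩ ⟨y', z', h1', h2', h3'⟩
    refine ⟨y + y', z + z', R.add_mem h1 h1', S.add_mem h2 h2', ?_⟩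
    rw [Prod.snd_add, h3, h3']
    abel
  zero_mem' := ⟨0, 0, R.zero_mem, S.zero_mem, by simp⟩
  smul_mem' := by
    rintro c a ⟨y, z, h1, h2, h3⟩
    refine ⟨c • y, c • z, R.smul_mem c h1, S.smul_mem c h2, ?_⟩
    rw [Prod.smul_snd, h3, smul_add]

/-- The relation `R - μ I = {(x, y - μ x) | (x, y) ∈ R}`. -/
def subSmulId (R : LinRel E E) (μ : ℂ) : LinRel E E where
  carrier := {p | ∃ y, (p.1, y) ∈ R ∧ p.2 = y - μ • p.1}
  add_mem' := by
    rintro a b ⟨y, h1, h2⟩ ⟨y', h1', h2'⟩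
    refine ⟨y + y', R.add_mem h1 h1', ?_⟩
    rw [Prod.snd_add, Prod.fst_add, h2, h2', smul_add]
    abel
  zero_mem' := ⟨0, R.zero_mem, by simp⟩
  smul_mem' := by
    rintro c a ⟨y, h1, h2⟩
    refine ⟨c • y, R.smul_mem c h1, ?_⟩
    rw [Prod.smul_snd, Prod.smul_fst, h2, smul_sub, smul_comm]

/-- The domain restriction `R|_L = {(x, y) ∈ R | x ∈ L}`. -/
def restrict (R : LinRel E F) (L : Submodule ℂ E) : LinRel E F :=
  R ⊓ L.comap (LinearMap.fst ℂ E F)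

/-- The image `R(L) = {y | ∃ x ∈ L, (x, y) ∈ R}`. -/
def image (R : LinRel E F) (L : Submodule ℂ E) : Submodule ℂ F :=
  (R.restrict L).map (LinearMap.snd ℂ E F)

/-- The adjoint of `R` with respect to sesquilinear forms (conjugate-linear in the first
argument) on `E` and `F`: all `(v, w) ∈ F × E` with `[x, w] = [y, v]` for every `(x, y) ∈ R`. -/
def formAdjoint (bE : E →ₗ⋆[ℂ] E →ₗ[ℂ] ℂ) (bF : F →ₗ⋆[ℂ] F →ₗ[ℂ] ℂ) (R : LinRel E F) :
    LinRel F E where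
  carrier := {p | ∀ x y, (x, y) ∈ R → bE x p.2 = bF y p.1}
  add_mem' := by
    intro a b ha hb x y h
    rw [Prod.snd_add, Prod.fst_add, map_add, map_add, ha x y h, hb x y h]
  zero_mem' := by
    intro x y _
    simp
  smul_mem' := by
    intro c a ha x y h
    rw [Prod.smul_snd, Prod.smul_fst, map_smul, map_smul, ha x y h]

end LinRel

namespace LinRel

variable {E F : Type*} [NormedAddCommGroup E] [InnerProductSpace ℂ E]
  [NormedAddCommGroup F] [InnerProductSpace ℂ F]

/-- The closure of `R` is an operator. -/
def IsClosable (R : LinRel E F) : Prop := IsOperator (Submodule.topologicalClosure R)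

/-- Boundedness on the domain: `‖y‖ ≤ C ‖x‖` for all `(x, y) ∈ R`, some constant `C`. -/
def IsBounded (R : LinRel E F) : Prop := ∃ C : ℝ, ∀ x y, (x, y) ∈ R → ‖y‖ ≤ C * ‖x‖

/-- Contractivity on the domain: `‖y‖ ≤ ‖x‖` for all `(x, y) ∈ R`. -/
def IsContraction (R : LinRel E F) : Prop := ∀ x y, (x, y) ∈ R → ‖y‖ ≤ ‖x‖

end LinRel

/-! ## Krein spaces -/

/-- A canonical symmetry of the Hilbert space `H`: a self-adjoint involution `J`. It makes `H`
a Krein space with indefinite metric `[x, y] = ⟪x, J y⟫` and canonical decomposition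
`H = H⁻ [⊕] H⁺`, where `H⁻` and `H⁺` are the eigenspaces of `J` for `-1` and `1`. Conversely, a
Krein space with a fixed canonical decomposition is of this form for the Hilbert metric
`⟪x, y⟫ = [x, J y]`, `J = P⁺ - P⁻`. -/
structure CanonicalSymmetry (H : Type*) [NormedAddCommGroup H] [InnerProductSpace ℂ H] where
  /-- The operator. -/
  J : H →L[ℂ] H
  symmetric : ∀ x y : H, ⟪J x, y⟫_ℂ = ⟪x, J y⟫_ℂ
  involutive : ∀ x : H, J (J x) = x

namespace CanonicalSymmetry

variable {H : Type*} [NormedAddCommGroup H] [InnerProductSpace ℂ H] (K : CanonicalSymmetry H)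

/-- The indefinite metric `[x, y] = ⟪x, J y⟫`. -/
def form : H →ₗ⋆[ℂ] H →ₗ[ℂ] ℂ := (innerₛₗ ℂ).compl₂ (K.J : H →ₗ[ℂ] H)

/-- The negative component `H⁻` of the canonical decomposition. -/
def Hminus : Submodule ℂ H where
  carrier := {x | K.J x = -x}
  add_mem' := by
    intro a b (ha : K.J a = -a) (hb : K.J b = -b)
    change K.J (a + b) = -(a + b)
    rw [map_add, ha, hb, neg_add]
  zero_mem' := by simp
  smul_mem' := by
    intro c a (ha : K.J a = -a)
    change K.J (c • a) = -(c • a)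
    rw [map_smul, ha, smul_neg]

/-- The positive component `H⁺` of the canonical decomposition. -/
def Hplus : Submodule ℂ H where
  carrier := {x | K.J x = x}
  add_mem' := by
    intro a b (ha : K.J a = a) (hb : K.J b = b)
    change K.J (a + b) = a + b
    rw [map_add, ha, hb]
  zero_mem' := by simp
  smul_mem' := by
    intro c a (ha : K.J a = a)
    change K.J (c • a) = c • a
    rw [map_smul, ha]

/-- The canonical projection `P⁻ = (I - J) / 2` onto `H⁻`. -/
def Pminus : H →ₗ[ℂ] K.Hminus :=
  LinearMap.codRestrict K.Hminus ((1 / 2 : ℂ) • (LinearMap.id - (K.J : H →ₗ[ℂ] H))) (by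
    intro x
    change K.J ((1 / 2 : ℂ) • (x - K.J x)) = -((1 / 2 : ℂ) • (x - K.J x))
    rw [map_smul, map_sub, K.involutive, ← smul_neg, neg_sub])

/-- The canonical projection `P⁺ = (I + J) / 2` onto `H⁺`. -/
def Pplus : H →ₗ[ℂ] K.Hplus :=
  LinearMap.codRestrict K.Hplus ((1 / 2 : ℂ) • (LinearMap.id + (K.J : H →ₗ[ℂ] H))) (by
    intro x
    change K.J ((1 / 2 : ℂ) • (x + K.J x)) = (1 / 2 : ℂ) • (x + K.J x)
    rw [map_smul, map_add, K.involutive, add_comm])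

/-- The restriction of the indefinite metric to a lineal. -/
def formOn (L : Submodule ℂ H) : L →ₗ⋆[ℂ] L →ₗ[ℂ] ℂ := K.form.domRestrict₁₂ L L

/-- The adjoint `Tᶜ` of a relation in `H` with respect to the indefinite metric: all `(u, v)`
with `[x, v] = [y, u]` for every `(x, y) ∈ T`. -/
def adj (T : LinRel H H) : LinRel H H := T.formAdjoint K.form K.form

/-- The relation `T` is self-adjoint in the Krein space. -/
def IsSelfAdj (T : LinRel H H) : Prop := T = K.adj T

/-- A lineal of class `A⁺`: it meets `H⁻` trivially. -/
def ClassAPlus (L : Submodule ℂ H) : Prop := K.Hminus ⊓ L = ⊥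

/-- A non-negative lineal: `[x, x] ≥ 0` on it (the number `[x, x]` is real). -/
def IsNonneg (L : Submodule ℂ H) : Prop := ∀ x ∈ L, 0 ≤ (K.form x x).re

/-- `T⁻⁻ = P⁻ T|_{H⁻}`, a relation in `H⁻`. -/
def Tmm (T : LinRel H H) : LinRel K.Hminus K.Hminus :=
  LinRel.comp (LinearMap.graph K.Pminus) (LinRel.comp T (LinearMap.graph K.Hminus.subtype))

/-- The relation `{(P⁻ x, P⁻ y) | (x, y) ∈ T, y - μ x ∈ H⁻}` in `H⁻`. -/
def Tminus (T : LinRel H H) (μ : ℂ) : LinRel K.Hminus K.Hminus :=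
  (T ⊓ K.Hminus.comap (LinearMap.snd ℂ H H - μ • LinearMap.fst ℂ H H)).map
    (K.Pminus.prodMap K.Pminus)

/-- The relation `{(P⁺ x, P⁺ y) | (x, y) ∈ T, y - μ x ∈ H⁺}` in `H⁺`. -/
def Tplus (T : LinRel H H) (μ : ℂ) : LinRel K.Hplus K.Hplus :=
  (T ⊓ K.Hplus.comap (LinearMap.snd ℂ H H - μ • LinearMap.fst ℂ H H)).map
    (K.Pplus.prodMap K.Pplus)

/-- The lineal `(T - μ I)⁻¹(H⁺)`. -/
def Llin (T : LinRel H H) (μ : ℂ) : Submodule ℂ H :=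
  (T.subSmulId μ).inv.image K.Hplus

/-- The relation `γ_μ = P⁻ (P⁺|_L)⁻¹` from `H⁺` to `H⁻`, with `L = (T - μ I)⁻¹(H⁺)`. -/
def gam (T : LinRel H H) (μ : ℂ) : LinRel K.Hplus K.Hminus :=
  LinRel.comp (LinearMap.graph K.Pminus)
    (LinRel.inv (LinRel.restrict (LinearMap.graph K.Pplus) (K.Llin T μ)))

/-- The adjoint of a relation from `H⁺` to `H⁻` with respect to the indefinite metrics that
`H⁺` and `H⁻` inherit from `H`; a relation from `H⁻` to `H⁺`. -/
def adjPM (R : LinRel K.Hplus K.Hminus) : LinRel K.Hminus K.Hplus :=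
  R.formAdjoint (K.formOn K.Hplus) (K.formOn K.Hminus)

end CanonicalSymmetry

end

/-! The pairs of `T` are written as `(x, μ x + z)`. Since `T⁻⁻` is symmetric and everywhere defined
on the Hilbert space `H⁻`, the relation `T⁻⁻ - μ I⁻` is onto: every `h ∈ H⁻` admits a pair
`(u, μ u + h - w) ∈ T` with `u ∈ H⁻` and `w ∈ H⁺`. Adding such pairs moves any element of the
domain of `T` into `(T - μ I)⁻¹(H⁺)` without changing its `H⁺`-component, which gives the domain of
`γ_μ`. The pairs `(h, w)` obtained in this way lie in the adjoint of `γ_{μ̄}`, so this adjoint is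
everywhere defined and `γ_{μ̄}` is bounded by the uniform boundedness principle. Finally, the
resolvent formula is the splitting `(x, μ x + h) = (u, μ u + h - w) + (x', μ x' + w)`. -/

lemma surjective_sub_smul_id_of_isSymmetric {E : Type*} [NormedAddCommGroup E]
    [InnerProductSpace ℂ E] [CompleteSpace E] {A : E →ₗ[ℂ] E} (hA : A.IsSymmetric) {μ : ℂ}
    (hμ : μ.im ≠ 0) : Function.Surjective (A - μ • (LinearMap.id : E →ₗ[ℂ] E)) := by
  let B : E →L[ℂ] E := ⟨A, hA.continuous⟩
  have hB : IsSelfAdjoint B := ContinuousLinearMap.isSelfAdjoint_iff_isSymmetric.2 hA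
  have hunit : IsUnit (algebraMap ℂ (E →L[ℂ] E) μ - B) :=
    spectrum.notMem_iff.1 fun hs => hμ (hB.im_eq_zero_of_mem_spectrum hs)
  obtain ⟨C, hC⟩ := hunit.exists_right_inv
  intro h
  have hCh : μ • C h - B (C h) = h := by
    simpa [Algebra.algebraMap_eq_smul_one] using congrArg (fun D => D h) hC
  refine ⟨-C h, ?_⟩
  calc (A - μ • (LinearMap.id : E →ₗ[ℂ] E)) (-C h) = μ • C h - A (C h) := by
        simp [neg_add_eq_sub]
    _ = h := hCh

namespace LinRel

section Algebra

variable {E F G G' : Type*} [AddCommGroup E] [Module ℂ E] [AddCommGroup F] [Module ℂ F]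
  [AddCommGroup G] [Module ℂ G] [AddCommGroup G'] [Module ℂ G']

lemma mem_dom {R : LinRel E F} {x : E} : x ∈ R.dom ↔ ∃ y, (x, y) ∈ R := by
  simp [dom]

lemma mem_inv_subSmulId {R : LinRel E E} {μ : ℂ} {x z : E} :
    (z, x) ∈ (R.subSmulId μ).inv ↔ (x, μ • x + z) ∈ R := by
  constructor
  · rintro ⟨y, hy, rfl : z = y - μ • x⟩
    rwa [add_sub_cancel]
  · exact fun h => ⟨_, h, (add_sub_cancel_left _ _).symm⟩

lemma comp_assoc (S₃ : LinRel G G') (S₂ : LinRel F G) (S₁ : LinRel E F) :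
    comp S₃ (comp S₂ S₁) = comp (comp S₃ S₂) S₁ := by
  ext ⟨x, z⟩
  constructor
  · rintro ⟨v, ⟨u, h₁, h₂⟩, h₃⟩
    exact ⟨u, h₁, v, h₂, h₃⟩
  · rintro ⟨u, h₁, v, h₂, h₃⟩
    exact ⟨v, ⟨u, h₁, h₂⟩, h₃⟩

lemma IsOperator.eq_of_mem {R : LinRel E F} (hR : R.IsOperator) {x : E} {y y' : F}
    (h : (x, y) ∈ R) (h' : (x, y') ∈ R) : y = y' := by
  have hsub : y - y' ∈ R.ind := by
    simpa [ind] using R.sub_mem h h'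
  rw [hR, Submodule.mem_bot] at hsub
  exact sub_eq_zero.1 hsub

lemma IsOperator.exists_eq_graph {R : LinRel E F} (hR : R.IsOperator) (hdom : R.dom = ⊤) :
    ∃ A : E →ₗ[ℂ] F, R = A.graph := by
  refine Submodule.exists_eq_graph ⟨?_, fun x => ?_⟩
  · rintro ⟨⟨x, y⟩, hy⟩ ⟨⟨x', y'⟩, hy'⟩ (rfl : x = x')
    simp only [hR.eq_of_mem hy hy']
  · obtain ⟨y, hy⟩ := mem_dom.1 (hdom ▸ Submodule.mem_top : x ∈ R.dom)
    exact ⟨⟨(x, y), hy⟩, rfl⟩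

/-- A relation in `E` is symmetric with respect to a sesquilinear form if it is contained in its
adjoint. -/
def IsSymmetric (b : E →ₗ⋆[ℂ] E →ₗ[ℂ] ℂ) (R : LinRel E E) : Prop := R ≤ R.formAdjoint b b

lemma IsSymmetric.apply_eq {b : E →ₗ⋆[ℂ] E →ₗ[ℂ] ℂ} {R : LinRel E E} (hR : R.IsSymmetric b)
    {x y u v : E} (h : (x, y) ∈ R) (h' : (u, v) ∈ R) : b x v = b y u :=
  hR h' x y h

end Algebra

section Hilbert

variable {E F : Type*} [NormedAddCommGroup E] [InnerProductSpace ℂ E]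
  [NormedAddCommGroup F] [InnerProductSpace ℂ F]

lemma IsSymmetric.isOperator {S : LinRel E E} (hS : S.IsSymmetric (innerₛₗ ℂ))
    (hdom : S.dom = ⊤) : S.IsOperator := by
  refine (Submodule.eq_bot_iff _).2 fun y (hy : (0, y) ∈ S) => ?_
  obtain ⟨v, hv⟩ := mem_dom.1 (hdom ▸ Submodule.mem_top : y ∈ S.dom)
  have hinner : ⟪(0 : E), v⟫_ℂ = ⟪y, y⟫_ℂ := hS.apply_eq hy hv
  rwa [inner_zero_left, eq_comm, inner_self_eq_zero] at hinner

lemma IsSymmetric.dom_inv_subSmulId [CompleteSpace E] {S : LinRel E E}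
    (hS : S.IsSymmetric (innerₛₗ ℂ)) (hdom : S.dom = ⊤) {μ : ℂ} (hμ : μ.im ≠ 0) :
    (S.subSmulId μ).inv.dom = ⊤ := by
  obtain ⟨A, rfl⟩ := (hS.isOperator hdom).exists_eq_graph hdom
  have mem_graph (x : E) : (x, A x) ∈ A.graph := rfl
  have hA : A.IsSymmetric := fun x y => (hS.apply_eq (mem_graph x) (mem_graph y)).symm
  refine Submodule.eq_top_iff'.2 fun h => mem_dom.2 ?_
  obtain ⟨x, rfl⟩ := surjective_sub_smul_id_of_isSymmetric hA hμ h
  exact ⟨x, mem_inv_subSmulId.2 (by simp)⟩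

lemma isBounded_of_forall_norm_inner_le [CompleteSpace F] {R : LinRel E F}
    (h : ∀ v, ∃ C : ℝ, ∀ x y, (x, y) ∈ R → ‖⟪y, v⟫_ℂ‖ ≤ C * ‖x‖) : R.IsBounded := by
  -- A pair with `x = 0` contributes the zero functional, as `0⁻¹ = 0`, and is treated separately.
  let g : R → F →L[ℂ] ℂ := fun p => ((‖p.1.1‖⁻¹ : ℝ) : ℂ) • innerSL ℂ p.1.2
  have norm_g_apply (p : R) (v : F) : ‖g p v‖ = ‖p.1.1‖⁻¹ * ‖⟪p.1.2, v⟫_ℂ‖ := by simp [g]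
  have norm_g (p : R) : ‖g p‖ = ‖p.1.1‖⁻¹ * ‖p.1.2‖ := by simp [g, norm_smul]
  obtain ⟨C, hC⟩ := banach_steinhaus (g := g) fun v => by
    obtain ⟨C, hC⟩ := h v
    refine ⟨|C|, fun ⟨⟨x, y⟩, hxy⟩ => ?_⟩
    rw [norm_g_apply]
    refine inv_mul_le_of_le_mul₀ (norm_nonneg _) (abs_nonneg C) ?_
    rw [mul_comm]
    exact (hC x y hxy).trans (by gcongr; exact le_abs_self C)
  refine ⟨C, fun x y hxy => ?_⟩
  rcases eq_or_ne x 0 with rfl | hx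
  · obtain ⟨C', hC'⟩ := h y
    have hy : ⟪y, y⟫_ℂ = 0 := by simpa using hC' 0 y hxy
    simp [inner_self_eq_zero.1 hy]
  · have hle := hC ⟨(x, y), hxy⟩
    rwa [norm_g, inv_mul_le_iff₀ (norm_pos_iff.2 hx), mul_comm] at hle

lemma IsBounded.isOperator {R : LinRel E F} (hR : R.IsBounded) : R.IsOperator := by
  obtain ⟨C, hC⟩ := hR
  refine (Submodule.eq_bot_iff _).2 fun y hy => norm_le_zero_iff.1 ?_
  simpa using hC 0 y hy

lemma IsBounded.topologicalClosure {R : LinRel E F} (hR : R.IsBounded) :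
    IsBounded (Submodule.topologicalClosure R) := by
  obtain ⟨C, hC⟩ := hR
  have hclosed : IsClosed {p : E × F | ‖p.2‖ ≤ C * ‖p.1‖} :=
    isClosed_le (by fun_prop) (by fun_prop)
  exact ⟨C, fun _ _ hxy => closure_minimal (fun p hp => hC p.1 p.2 hp) hclosed hxy⟩

lemma IsBounded.isClosable {R : LinRel E F} (hR : R.IsBounded) : R.IsClosable :=
  hR.topologicalClosure.isOperator

end Hilbert

end LinRel

namespace CanonicalSymmetry

open LinRel

variable {H : Type*} [NormedAddCommGroup H] [InnerProductSpace ℂ H]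

section Decomposition

variable (K : CanonicalSymmetry H)

lemma coe_Pplus (x : H) : (K.Pplus x : H) = (1 / 2 : ℂ) • (x + K.J x) := rfl

lemma coe_Pminus (x : H) : (K.Pminus x : H) = (1 / 2 : ℂ) • (x - K.J x) := rfl

lemma Pplus_add_Pminus (x : H) : (K.Pplus x : H) + K.Pminus x = x := by
  rw [coe_Pplus, coe_Pminus]
  module

lemma J_Hplus (a : K.Hplus) : K.J a = a := a.2

lemma J_Hminus (a : K.Hminus) : K.J a = -a := a.2

@[simp] lemma Pplus_Hplus (a : K.Hplus) : K.Pplus a = a := by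
  ext
  rw [coe_Pplus, J_Hplus]
  module

@[simp] lemma Pminus_Hminus (a : K.Hminus) : K.Pminus a = a := by
  ext
  rw [coe_Pminus, J_Hminus]
  module

@[simp] lemma Pminus_Hplus (a : K.Hplus) : K.Pminus a = 0 := by
  ext
  simp [coe_Pminus, J_Hplus]

@[simp] lemma Pplus_Hminus (a : K.Hminus) : K.Pplus a = 0 := by
  ext
  simp [coe_Pplus, J_Hminus]

lemma isClosed_Hminus : IsClosed (K.Hminus : Set H) :=
  isClosed_eq K.J.continuous continuous_neg

lemma form_apply (x y : H) : K.form x y = ⟪x, K.J y⟫_ℂ := rfl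

lemma form_Pplus (x y : H) : K.form (K.Pplus x) y = K.form x (K.Pplus y) := by
  simp only [form_apply, J_Hplus]
  simp only [coe_Pplus, inner_smul_left, inner_smul_right, inner_add_left, inner_add_right,
    K.symmetric, K.involutive, map_div₀, map_one, map_ofNat]
  ring

lemma form_Pminus (x y : H) : K.form (K.Pminus x) y = K.form x (K.Pminus y) := by
  simp only [form_apply, J_Hminus]
  simp only [coe_Pminus, inner_smul_left, inner_smul_right, inner_sub_left, inner_sub_right,
    inner_neg_right, K.symmetric, K.involutive, map_div₀, map_one, map_ofNat]
  ring

lemma formOn_Pplus (x : H) (a : K.Hplus) : K.formOn K.Hplus (K.Pplus x) a = K.form x a :=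
  (K.form_Pplus x a).trans (by rw [Pplus_Hplus])

lemma formOn_Pminus (x : H) (a : K.Hminus) : K.formOn K.Hminus (K.Pminus x) a = K.form x a :=
  (K.form_Pminus x a).trans (by rw [Pminus_Hminus])

@[simp] lemma form_Hplus_Hminus (a : K.Hplus) (b : K.Hminus) : K.form a b = 0 := by
  rw [← formOn_Pminus, Pminus_Hplus, map_zero, LinearMap.zero_apply]

@[simp] lemma form_Hminus_Hplus (a : K.Hminus) (b : K.Hplus) : K.form a b = 0 := by
  rw [← formOn_Pplus, Pplus_Hminus, map_zero, LinearMap.zero_apply]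

lemma formOn_Hplus (a b : K.Hplus) : K.formOn K.Hplus a b = ⟪a, b⟫_ℂ := by
  change ⟪(a : H), K.J b⟫_ℂ = _
  rw [J_Hplus, Submodule.coe_inner]

lemma formOn_Hminus (a b : K.Hminus) : K.formOn K.Hminus a b = -⟪a, b⟫_ℂ := by
  change ⟪(a : H), K.J b⟫_ℂ = _
  rw [J_Hminus, inner_neg_right, Submodule.coe_inner]

lemma re_form_self (x : H) : (K.form x x).re = ‖K.Pplus x‖ ^ 2 - ‖K.Pminus x‖ ^ 2 := by
  have hform : K.form x x = ⟪K.Pplus x, K.Pplus x⟫_ℂ - ⟪K.Pminus x, K.Pminus x⟫_ℂ := by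
    rw [← formOn_Hplus, sub_eq_add_neg, ← formOn_Hminus, formOn_Pplus, formOn_Pminus, ← map_add,
      Pplus_add_Pminus]
  rw [hform, inner_self_eq_norm_sq_to_K, inner_self_eq_norm_sq_to_K]
  norm_cast

lemma isSymmetric_formOn_Hminus_iff {S : LinRel K.Hminus K.Hminus} :
    S.IsSymmetric (K.formOn K.Hminus) ↔ S.IsSymmetric (innerₛₗ ℂ) := by
  have hadj : S.formAdjoint (K.formOn K.Hminus) (K.formOn K.Hminus) =
      S.formAdjoint (innerₛₗ ℂ) (innerₛₗ ℂ) := by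
    ext p
    change (∀ x y, _ → _ = _) ↔ ∀ x y, _ → ⟪x, p.2⟫_ℂ = ⟪y, p.1⟫_ℂ
    simp only [formOn_Hminus, neg_inj]
  rw [IsSymmetric, IsSymmetric, hadj]

lemma map_Pplus_eq_comap_of_Hminus_le {D : Submodule ℂ H} (hD : K.Hminus ≤ D) :
    D.map K.Pplus = D.comap K.Hplus.subtype := by
  ext s
  constructor
  · rintro ⟨x, hx, rfl⟩
    have hPx : (K.Pplus x : H) = x - K.Pminus x := eq_sub_of_add_eq (K.Pplus_add_Pminus x)
    change (K.Pplus x : H) ∈ D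
    rw [hPx]
    exact D.sub_mem hx (hD (K.Pminus x).2)
  · exact fun hs => ⟨s, hs, K.Pplus_Hplus s⟩

end Decomposition

section Angular

variable (K : CanonicalSymmetry H) (L : Submodule ℂ H)

/-- The angular relation `P⁻ (P⁺|_L)⁻¹` of a lineal `L`, whose pairs are the components
`(P⁺ x, P⁻ x)` of the elements of `L`. The relation `γ_μ` is that of `(T - μ I)⁻¹(H⁺)`. -/
noncomputable def angular : LinRel K.Hplus K.Hminus :=
  comp (LinearMap.graph K.Pminus) (inv (restrict (LinearMap.graph K.Pplus) L))

variable {K L}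

lemma mem_angular {s : K.Hplus} {b : K.Hminus} :
    (s, b) ∈ K.angular L ↔ ∃ x ∈ L, K.Pplus x = s ∧ K.Pminus x = b := by
  constructor
  · rintro ⟨x, ⟨hs, hx⟩, hb⟩
    exact ⟨x, hx, hs.symm, hb.symm⟩
  · rintro ⟨x, hx, hs, hb⟩
    exact ⟨x, ⟨hs.symm, hx⟩, hb.symm⟩

lemma dom_angular : (K.angular L).dom = L.map K.Pplus := by
  ext s
  simp only [mem_dom, mem_angular, Submodule.mem_map]
  exact ⟨fun ⟨_, x, hx, hs, _⟩ => ⟨x, hx, hs⟩, fun ⟨x, hx, hs⟩ => ⟨_, x, hx, hs, rfl⟩⟩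

lemma ClassAPlus.isOperator_angular (hL : K.ClassAPlus L) : (K.angular L).IsOperator := by
  refine (Submodule.eq_bot_iff _).2 fun b (hb : (0, b) ∈ K.angular L) => ?_
  obtain ⟨x, hx, hxp, rfl⟩ := mem_angular.1 hb
  have hxm : (K.Pminus x : H) = x := by simpa [hxp] using K.Pplus_add_Pminus x
  have hmem : x ∈ K.Hminus ⊓ L := ⟨hxm ▸ (K.Pminus x).2, hx⟩
  rw [hL, Submodule.mem_bot] at hmem
  rw [hmem, map_zero]

lemma isContraction_angular_iff : (K.angular L).IsContraction ↔ K.IsNonneg L := by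
  have hiff (x : H) : ‖K.Pminus x‖ ≤ ‖K.Pplus x‖ ↔ 0 ≤ (K.form x x).re := by
    rw [re_form_self, sub_nonneg, sq_le_sq₀ (norm_nonneg _) (norm_nonneg _)]
  constructor
  · exact fun hc x hx => (hiff x).1 (hc _ _ (mem_angular.2 ⟨x, hx, rfl, rfl⟩))
  · intro hL s b hsb
    obtain ⟨x, hx, rfl, rfl⟩ := mem_angular.1 hsb
    exact (hiff x).2 (hL x hx)

lemma mem_adjPM_angular {h : K.Hminus} {w : K.Hplus} :
    (h, w) ∈ K.adjPM (K.angular L) ↔ ∀ x ∈ L, K.form x w = K.form x h := by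
  constructor
  · intro hw x hx
    rw [← formOn_Pplus, ← formOn_Pminus]
    exact hw _ _ (mem_angular.2 ⟨x, hx, rfl, rfl⟩)
  · intro hw s b hsb
    obtain ⟨x, hx, rfl, rfl⟩ := mem_angular.1 hsb
    rw [formOn_Pplus, formOn_Pminus]
    exact hw x hx

lemma isBounded_of_dom_adjPM_eq_top [CompleteSpace K.Hminus] {R : LinRel K.Hplus K.Hminus}
    (hR : (K.adjPM R).dom = ⊤) : R.IsBounded := by
  refine isBounded_of_forall_norm_inner_le fun v => ?_
  obtain ⟨w, hw⟩ := mem_dom.1 (hR ▸ Submodule.mem_top : v ∈ (K.adjPM R).dom)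
  refine ⟨‖w‖, fun x y hxy => ?_⟩
  have hadj : ⟪x, w⟫_ℂ = -⟪y, v⟫_ℂ := by
    rw [← formOn_Hplus, ← formOn_Hminus]
    exact hw x y hxy
  calc ‖⟪y, v⟫_ℂ‖ = ‖⟪x, w⟫_ℂ‖ := by rw [hadj, norm_neg]
    _ ≤ ‖x‖ * ‖w‖ := norm_inner_le_norm x w
    _ = ‖w‖ * ‖x‖ := mul_comm _ _

end Angular

section Membership

variable {K : CanonicalSymmetry H} {T : LinRel H H} {μ : ℂ}

lemma gam_eq_angular : K.gam T μ = K.angular (K.Llin T μ) := rfl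

lemma mem_Llin {x : H} : x ∈ K.Llin T μ ↔ ∃ w : K.Hplus, (x, μ • x + w) ∈ T := by
  constructor
  · rintro ⟨⟨w, x⟩, ⟨hx, hw⟩, rfl⟩
    exact ⟨⟨w, hw⟩, mem_inv_subSmulId.1 hx⟩
  · rintro ⟨w, hx⟩
    exact ⟨((w : H), x), ⟨mem_inv_subSmulId.2 hx, w.2⟩, rfl⟩

lemma Llin_le_dom : K.Llin T μ ≤ T.dom := fun _ hx =>
  let ⟨_, hxw⟩ := mem_Llin.1 hx
  mem_dom.2 ⟨_, hxw⟩

lemma mem_inv_Tplus_subSmulId {w s : K.Hplus} :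
    (w, s) ∈ ((K.Tplus T μ).subSmulId μ).inv ↔ ∃ x : H, (x, μ • x + w) ∈ T ∧ K.Pplus x = s := by
  rw [mem_inv_subSmulId]
  constructor
  · rintro ⟨⟨x, y⟩, ⟨hxy, hy⟩, hP⟩
    obtain ⟨rfl, hPy⟩ := Prod.ext_iff.1 hP
    obtain ⟨z, hz⟩ : ∃ z : K.Hplus, (z : H) = y - μ • x := ⟨⟨_, hy⟩, rfl⟩
    obtain rfl : y = μ • x + z := by rw [hz, add_sub_cancel]
    obtain rfl : z = w := by simpa using hPy
    exact ⟨x, hxy, rfl⟩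
  · rintro ⟨x, hx, rfl⟩
    exact ⟨(x, μ • x + w), ⟨hx, by simp⟩, by simp⟩

lemma mem_inv_Tminus_subSmulId {h k : K.Hminus} :
    (h, k) ∈ ((K.Tminus T μ).subSmulId μ).inv ↔ ∃ x : H, (x, μ • x + h) ∈ T ∧ K.Pminus x = k := by
  rw [mem_inv_subSmulId]
  constructor
  · rintro ⟨⟨x, y⟩, ⟨hxy, hy⟩, hP⟩
    obtain ⟨rfl, hPy⟩ := Prod.ext_iff.1 hP
    obtain ⟨z, hz⟩ : ∃ z : K.Hminus, (z : H) = y - μ • x := ⟨⟨_, hy⟩, rfl⟩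
    obtain rfl : y = μ • x + z := by rw [hz, add_sub_cancel]
    obtain rfl : z = h := by simpa using hPy
    exact ⟨x, hxy, rfl⟩
  · rintro ⟨x, hx, rfl⟩
    exact ⟨(x, μ • x + h), ⟨hx, by simp⟩, by simp⟩

lemma mem_Tmm {a b : K.Hminus} : (a, b) ∈ K.Tmm T ↔ ∃ y, ((a : H), y) ∈ T ∧ K.Pminus y = b := by
  constructor
  · rintro ⟨y, ⟨z, rfl : z = (a : H), hy⟩, hb⟩
    exact ⟨y, hy, hb.symm⟩
  · rintro ⟨y, hy, hb⟩
    exact ⟨y, ⟨(a : H), rfl, hy⟩, hb.symm⟩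

lemma mem_inv_Tmm_subSmulId {h a : K.Hminus} :
    (h, a) ∈ ((K.Tmm T).subSmulId μ).inv ↔ ∃ w : K.Hplus, ((a : H), μ • (a : H) + h - w) ∈ T := by
  rw [mem_inv_subSmulId, mem_Tmm]
  constructor
  · rintro ⟨y, hy, hP⟩
    refine ⟨-K.Pplus y, ?_⟩
    rwa [show μ • (a : H) + h = K.Pminus y by simp [hP], Submodule.coe_neg, sub_neg_eq_add,
      add_comm, Pplus_add_Pminus]
  · rintro ⟨w, hw⟩
    exact ⟨_, hw, by simp⟩

lemma dom_Tplus : (K.Tplus T μ).dom = (K.Llin T μ).map K.Pplus := by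
  ext s
  constructor
  · intro hs
    obtain ⟨t, ht⟩ := mem_dom.1 hs
    have hres : (t - μ • s, s) ∈ ((K.Tplus T μ).subSmulId μ).inv := by
      rwa [mem_inv_subSmulId, add_sub_cancel]
    obtain ⟨x, hx, hxs⟩ := mem_inv_Tplus_subSmulId.1 hres
    exact ⟨x, mem_Llin.2 ⟨_, hx⟩, hxs⟩
  · rintro ⟨x, hx, rfl⟩
    obtain ⟨w, hw⟩ := mem_Llin.1 hx
    exact mem_dom.2 ⟨_, mem_inv_subSmulId.1 (mem_inv_Tplus_subSmulId.2 ⟨x, hw, rfl⟩)⟩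

lemma dom_Tmm (hdom : K.Hminus ≤ T.dom) : (K.Tmm T).dom = ⊤ := by
  refine Submodule.eq_top_iff'.2 fun a => mem_dom.2 ?_
  obtain ⟨y, hy⟩ := mem_dom.1 (hdom a.2)
  exact ⟨K.Pminus y, mem_Tmm.2 ⟨y, hy, rfl⟩⟩

lemma mem_gam_comp_inv_Tplus_subSmulId (hL : K.ClassAPlus (K.Llin T μ)) {w : K.Hplus}
    {b : K.Hminus} :
    (w, b) ∈ comp (K.gam T μ) ((K.Tplus T μ).subSmulId μ).inv ↔
      ∃ x : H, (x, μ • x + w) ∈ T ∧ K.Pminus x = b := by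
  have hgam {x : H} (hx : (x, μ • x + w) ∈ T) : (K.Pplus x, K.Pminus x) ∈ K.gam T μ :=
    mem_angular.2 ⟨x, mem_Llin.2 ⟨w, hx⟩, rfl, rfl⟩
  constructor
  · rintro ⟨s, hws, hsb⟩
    obtain ⟨x, hx, rfl⟩ := mem_inv_Tplus_subSmulId.1 hws
    exact ⟨x, hx, hL.isOperator_angular.eq_of_mem (hgam hx) hsb⟩
  · rintro ⟨x, hx, rfl⟩
    exact ⟨K.Pplus x, mem_inv_Tplus_subSmulId.2 ⟨x, hx, rfl⟩, hgam hx⟩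

end Membership

section Symmetric

variable {K : CanonicalSymmetry H} {T : LinRel H H} {μ : ℂ}

lemma eq_zero_of_mem_of_isSymmetric (hT : T.IsSymmetric K.form) (hμ : μ.im ≠ 0) {u : K.Hminus}
    {w : K.Hplus} (h : ((u : H), μ • (u : H) + w) ∈ T) : u = 0 := by
  have hform : μ * K.form u u = conj μ * K.form u u := by
    simpa using hT.apply_eq h h
  have hμconj : μ ≠ conj μ := fun hconj => hμ (Complex.conj_eq_iff_im.1 hconj.symm)
  have hzero : K.formOn K.Hminus u u = 0 :=
    (mul_eq_mul_right_iff.1 hform).resolve_left hμconj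
  rwa [formOn_Hminus, neg_eq_zero, inner_self_eq_zero] at hzero

lemma classAPlus_Llin (hT : T.IsSymmetric K.form) (hμ : μ.im ≠ 0) :
    K.ClassAPlus (K.Llin T μ) := by
  refine (Submodule.eq_bot_iff _).2 fun x ⟨hx, hL⟩ => ?_
  obtain ⟨w, hw⟩ := mem_Llin.1 hL
  lift x to K.Hminus using hx
  rw [eq_zero_of_mem_of_isSymmetric hT hμ hw, Submodule.coe_zero]

lemma isSymmetric_Tmm (hT : T.IsSymmetric K.form) :
    (K.Tmm T).IsSymmetric (K.formOn K.Hminus) := by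
  rintro ⟨b, _⟩ hb a _ ha
  obtain ⟨v, hv, rfl⟩ := mem_Tmm.1 hb
  obtain ⟨y, hy, rfl⟩ := mem_Tmm.1 ha
  calc K.form a (K.Pminus v) = K.form a v := by rw [← form_Pminus, Pminus_Hminus]
    _ = K.form y b := hT.apply_eq hy hv
    _ = K.formOn K.Hminus (K.Pminus y) b := (K.formOn_Pminus y b).symm

lemma mem_adjPM_gam_conj_of_mem (hT : T.IsSymmetric K.form) {u h : K.Hminus} {w : K.Hplus}
    (hu : ((u : H), μ • (u : H) + h - w) ∈ T) : (h, w) ∈ K.adjPM (K.gam T (conj μ)) := by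
  refine mem_adjPM_angular.2 fun x hx => ?_
  obtain ⟨z, hz⟩ := mem_Llin.1 hx
  have hform : μ * K.form x u + K.form x h - K.form x w = μ * K.form x u := by
    simpa using hT.apply_eq hz hu
  linear_combination -hform

variable [CompleteSpace K.Hminus]

lemma exists_mem_of_Hminus_le_dom (hT : T.IsSymmetric K.form) (hdom : K.Hminus ≤ T.dom)
    (hμ : μ.im ≠ 0) (h : K.Hminus) :
    ∃ (u : K.Hminus) (w : K.Hplus), ((u : H), μ • (u : H) + h - w) ∈ T := by
  have hTmm := K.isSymmetric_formOn_Hminus_iff.1 (isSymmetric_Tmm hT)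
  have hh : h ∈ ((K.Tmm T).subSmulId μ).inv.dom := by
    simp only [hTmm.dom_inv_subSmulId (dom_Tmm hdom) hμ, Submodule.mem_top]
  obtain ⟨u, hu⟩ := mem_dom.1 hh
  exact ⟨u, mem_inv_Tmm_subSmulId.1 hu⟩

lemma map_Pplus_Llin (hT : T.IsSymmetric K.form) (hdom : K.Hminus ≤ T.dom) (hμ : μ.im ≠ 0) :
    (K.Llin T μ).map K.Pplus = T.dom.map K.Pplus := by
  refine le_antisymm (Submodule.map_mono Llin_le_dom) ?_
  rintro _ ⟨x, hx, rfl⟩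
  obtain ⟨y, hxy⟩ := mem_dom.1 hx
  obtain ⟨u, w, hu⟩ := exists_mem_of_Hminus_le_dom hT hdom hμ (-K.Pminus (y - μ • x))
  refine ⟨x + u, mem_Llin.2 ⟨K.Pplus (y - μ • x) - w, ?_⟩, by simp⟩
  convert T.add_mem hxy hu using 1
  refine Prod.ext rfl ?_
  have hsplit := K.Pplus_add_Pminus (y - μ • x)
  simp only [Prod.snd_add, Submodule.coe_sub, Submodule.coe_neg]
  linear_combination (norm := module) hsplit

lemma dom_adjPM_gam (hT : T.IsSymmetric K.form) (hdom : K.Hminus ≤ T.dom) (hμ : μ.im ≠ 0) :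
    (K.adjPM (K.gam T μ)).dom = ⊤ := by
  refine Submodule.eq_top_iff'.2 fun h => mem_dom.2 ?_
  obtain ⟨u, w, hu⟩ := exists_mem_of_Hminus_le_dom hT hdom (μ := conj μ) (by simpa using hμ) h
  exact ⟨w, by simpa using mem_adjPM_gam_conj_of_mem hT hu⟩

lemma mem_adjPM_gam_conj_iff (hT : K.IsSelfAdj T) (hdom : K.Hminus ≤ T.dom) (hμ : μ.im ≠ 0)
    {h : K.Hminus} {w : K.Hplus} :
    (h, w) ∈ K.adjPM (K.gam T (conj μ)) ↔
      ∃ u : K.Hminus, ((u : H), μ • (u : H) + h - w) ∈ T := by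
  have hsymm : T.IsSymmetric K.form := hT.le
  have hμ' : (conj μ).im ≠ 0 := by simpa using hμ
  refine ⟨fun hw => ?_, fun ⟨u, hu⟩ => mem_adjPM_gam_conj_of_mem hsymm hu⟩
  obtain ⟨u, w₀, hu⟩ := exists_mem_of_Hminus_le_dom hsymm hdom hμ h
  have hw₀ := mem_adjPM_gam_conj_of_mem hsymm hu
  -- `w - w₀` is orthogonal to `P⁺(D_T)`, so it lies in the multivalued part of `Tᶜ = T`.
  have hmul : ((0 : H), ((w - w₀ : K.Hplus) : H)) ∈ T := by
    rw [hT]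
    intro x y hxy
    have hx : K.Pplus x ∈ (K.Llin T (conj μ)).map K.Pplus := by
      rw [map_Pplus_Llin hsymm hdom hμ']
      exact ⟨x, mem_dom.2 ⟨y, hxy⟩, rfl⟩
    obtain ⟨x', hx', hP⟩ := hx
    calc K.form x (w - w₀ : K.Hplus) = K.form x' (w - w₀ : K.Hplus) := by
          rw [← formOn_Pplus, ← formOn_Pplus, hP]
      _ = 0 := by
          rw [Submodule.coe_sub, map_sub, mem_adjPM_angular.1 hw x' hx',
            mem_adjPM_angular.1 hw₀ x' hx', sub_self]
      _ = K.form y 0 := (map_zero _).symm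
  exact ⟨u, by simpa using T.sub_mem hu hmul⟩

theorem inv_Tminus_subSmulId_eq (hT : K.IsSelfAdj T) (hdom : K.Hminus ≤ T.dom)
    (hμ : μ.im ≠ 0) :
    ((K.Tminus T μ).subSmulId μ).inv =
      opSum ((K.Tmm T).subSmulId μ).inv
        (comp (K.gam T μ)
          (comp ((K.Tplus T μ).subSmulId μ).inv (K.adjPM (K.gam T (conj μ))))) := by
  have hsymm : T.IsSymmetric K.form := hT.le
  have hL := classAPlus_Llin hsymm hμ
  rw [comp_assoc]
  ext ⟨h, k⟩
  rw [mem_inv_Tminus_subSmulId]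
  constructor
  · rintro ⟨x, hx, rfl⟩
    obtain ⟨u, w, hu⟩ := exists_mem_of_Hminus_le_dom hsymm hdom hμ h
    have hdiff : (x - u, μ • (x - u) + w) ∈ T := by
      convert T.sub_mem hx hu using 1
      refine Prod.ext rfl ?_
      simp only [Prod.snd_sub]
      module
    exact ⟨u, K.Pminus (x - u), mem_inv_Tmm_subSmulId.2 ⟨w, hu⟩,
      ⟨w, mem_adjPM_gam_conj_of_mem hsymm hu,
        (mem_gam_comp_inv_Tplus_subSmulId hL).2 ⟨_, hdiff, rfl⟩⟩, by simp⟩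
  · rintro ⟨a, b, ha : (h, a) ∈ _, ⟨w, hw : (h, w) ∈ _, hb : (w, b) ∈ _⟩, rfl : k = a + b⟩
    obtain ⟨w', hw'⟩ := mem_inv_Tmm_subSmulId.1 ha
    obtain ⟨u, hu⟩ := (mem_adjPM_gam_conj_iff hT hdom hμ).1 hw
    obtain ⟨x, hx, rfl⟩ := (mem_gam_comp_inv_Tplus_subSmulId hL).1 hb
    have hdiff : (((u - a : K.Hminus) : H), μ • ((u - a : K.Hminus) : H) + (w' - w : K.Hplus)) ∈
        T := by
      convert T.sub_mem hu hw' using 1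
      refine Prod.ext rfl ?_
      simp only [Prod.snd_sub, Submodule.coe_sub]
      module
    obtain rfl : u = a := sub_eq_zero.1 (eq_zero_of_mem_of_isSymmetric hsymm hμ hdiff)
    refine ⟨u + x, ?_, by simp⟩
    convert T.add_mem hu hx using 1
    refine Prod.ext rfl ?_
    simp only [Prod.snd_add]
    module

end Symmetric

end CanonicalSymmetry

open CanonicalSymmetry in
theorem proposition7p2_general {H : Type*} [NormedAddCommGroup H] [InnerProductSpace ℂ H]
    (K : CanonicalSymmetry H) [CompleteSpace K.Hminus] (T : LinRel H H)
    (hT : T.IsSymmetric K.form) (hdom : K.Hminus ≤ T.dom) (μ : ℂ) (hμ : μ.im ≠ 0) :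
    (K.ClassAPlus (K.Llin T μ) ∧
      (K.gam T μ).IsOperator ∧
      (K.gam T μ).IsClosable ∧
      (K.gam T μ).dom = (K.Llin T μ).map K.Pplus ∧
      (K.gam T μ).dom = T.dom.comap K.Hplus.subtype ∧
      (K.gam T μ).dom = (K.Tplus T μ).dom ∧
      (K.adjPM (K.gam T μ)).dom = ⊤ ∧
      (K.gam T μ).IsBounded ∧
      ((K.gam T μ).IsContraction ↔ K.IsNonneg (K.Llin T μ))) ∧
    (K.IsSelfAdj T → ((K.Tminus T μ).subSmulId μ).inv =
      LinRel.opSum ((K.Tmm T).subSmulId μ).inv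
        (LinRel.comp (K.gam T μ)
          (LinRel.comp ((K.Tplus T μ).subSmulId μ).inv (K.adjPM (K.gam T (conj μ)))))) := by
  have hL := classAPlus_Llin hT hμ
  have hdom_gam : (K.gam T μ).dom = (K.Llin T μ).map K.Pplus := dom_angular
  have hdom_adj := dom_adjPM_gam hT hdom hμ
  have hbdd := isBounded_of_dom_adjPM_eq_top hdom_adj
  exact ⟨⟨hL, hL.isOperator_angular, hbdd.isClosable, hdom_gam,
    hdom_gam.trans ((map_Pplus_Llin hT hdom hμ).trans
      (K.map_Pplus_eq_comap_of_Hminus_le hdom)),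
    hdom_gam.trans dom_Tplus.symm, hdom_adj, hbdd,
    isContraction_angular_iff⟩,
    fun hself => inv_Tminus_subSmulId_eq hself hdom hμ⟩

theorem proposition7p2 {H : Type*} [NormedAddCommGroup H] [InnerProductSpace ℂ H]
    [CompleteSpace H] (K : CanonicalSymmetry H) (T : LinRel H H)
    (hT : K.IsSelfAdj T) (hdom : K.Hminus ≤ T.dom) (μ : ℂ) (hμ : μ.im ≠ 0) :
    (K.ClassAPlus (K.Llin T μ) ∧
      (K.gam T μ).IsOperator ∧
      (K.gam T μ).IsClosable ∧
      (K.gam T μ).dom = (K.Llin T μ).map K.Pplus ∧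
      (K.gam T μ).dom = T.dom.comap K.Hplus.subtype ∧
      (K.gam T μ).dom = (K.Tplus T μ).dom ∧
      (K.adjPM (K.gam T μ)).dom = ⊤ ∧
      (K.gam T μ).IsBounded ∧
      ((K.gam T μ).IsContraction ↔ K.IsNonneg (K.Llin T μ))) ∧
    ((K.Tminus T μ).subSmulId μ).inv =
      LinRel.opSum ((K.Tmm T).subSmulId μ).inv
        (LinRel.comp (K.gam T μ)
          (LinRel.comp ((K.Tplus T μ).subSmulId μ).inv (K.adjPM (K.gam T (conj μ))))) := by
  have : CompleteSpace K.Hminus := K.isClosed_Hminus.completeSpace_coe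
  exact (proposition7p2_general K T hT.le hdom μ hμ).imp_right fun resolvent => resolvent hT
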